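/- Let $m\in\mathbb N$, $T>0$, $\Omega=(0,1)$, and let $B=\operatorname{diag}(b_1,\dots,b_m)$ with $b_1,\dots,b_m\in\mathbb R$. Let $u_0\in L^\infty(\Omega,\mathbb R^m)$, let $g=(g_1,\dots,g_m):[0,T]\to\mathbb R^m$ be Lipschitz continuous, and put $\eta(v)=\tfrac12|v|^2$, $q(v)=\tfrac12\,v\cdot Bv$. Let $u\in L^\infty((0,T)\times\Omega,\mathbb R^m)$ be an entropy solution of $\partial_t u+B\,\partial_x u=0$ with initial data $u_0$ with respect to $(\eta,q)$, that is, $$\int_0^T\!\!\int_\Omega \partial_t\phi\cdot u+\partial_x\phi\cdot Bu\,dx\,dt+\int_\Omega u_0\cdot\phi(0,\cdot)\,dx=0\qquad\text{for all }\phi\in C_0^\infty([0,T)\times\Omega,\mathbb R^m),$$ $$\int_0^T\!\!\int_\Omega \partial_t\Phi\,\eta(u)+\partial_x\Phi\,q(u)\,dx\,dt+\int_\Omega \Phi(0,\cdot)\,\eta(u_0)\,dx\ge0\qquad\text{for all }\Phi\in C_0^\infty([0,T)\times\Omega,[0,\infty)).$$ Suppose that $u$ attains the data $g$ on the incoming characteristics,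 in the sense of weak traces: if $b_i>0$, then $$\int_0^T\!\!\int_\Omega(\partial_t\varphi+b_i\partial_x\varphi)\,u_i\,dx\,dt+\int_0^T b_i\,g_i(t)\,\varphi(t,0)\,dt=0\qquad\text{for all }\varphi\in C_0^\infty((0,T)\times[0,1)),$$ and if $b_i<0$, then $$\int_0^T\!\!\int_\Omega(\partial_t\varphi+b_i\partial_x\varphi)\,u_i\,dx\,dt-\int_0^T b_i\,g_i(t)\,\varphi(t,1)\,dt=0\qquad\text{for all }\varphi\in C_0^\infty((0,T)\times(0,1]).$$ Let $\widehat u\in W^{1,\infty}((0,T)\times\Omega,\mathbb R^m)$, identified with its Lipschitz continuous representative on $[0,T]\times[0,1]$, satisfy $$\partial_t\widehat u+B\,\partial_x\widehat u=r_1\quad\text{a.e. in }(0,T)\times\Omega,\qquad \widehat u(0,\cdot)=\widehat u_0\quad\text{in }\Omega,$$ with the same incoming boundary data: $\widehat u_i(t,0)=g_i(t)$ if $b_i>0$, and $\widehat u_i(t,1)=g_i(t)$ if $b_i<0$, for $t\in(0,T)$. Then for almost all $t\in(0,T)$, $$\frac14\,\|u-\widehat u\|^2_{L^\infty(0,t;L^2(\Omega))}\le\frac12\,\|u_0-\widehat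 u_0\|^2_{L^2(\Omega)}+\|r_1\|^2_{L^1(0,t;L^2(\Omega))}.$$ -/

import Mathlib

open MeasureTheory Set
open scoped ENNReal NNReal ContDiff

namespace LinHyp

/-- The state space `ℝ^m` with its Euclidean norm. -/
abbrev State (m : ℕ) : Type := EuclideanSpace ℝ (Fin m)

/-- The space-time cylinder `(0,T) × Ω` with `Ω = (0,1)`; points are written `(t, x)`. -/
def cyl (T : ℝ) : Set (ℝ × ℝ) := Ioo (0 : ℝ) T ×ˢ Ioo (0 : ℝ) 1

/-- The time derivative of a function of `(t, x)`. -/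
noncomputable def dt {F : Type*} [NormedAddCommGroup F] [NormedSpace ℝ F]
    (φ : ℝ × ℝ → F) (z : ℝ × ℝ) : F := fderiv ℝ φ z (1, 0)

/-- The space derivative of a function of `(t, x)`. -/
noncomputable def dx {F : Type*} [NormedAddCommGroup F] [NormedSpace ℝ F]
    (φ : ℝ × ℝ → F) (z : ℝ × ℝ) : F := fderiv ℝ φ z (0, 1)

/-- Smooth functions with compact support in `S`. With `S = (-∞,T) × (0,1)` and functions
looked at on `t ≥ 0` only, these are the test functions of class `C_0^∞([0,T) × Ω)`. -/
structure IsTest {F : Type*} [NormedAddCommGroup F] [NormedSpace ℝ F]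
    (S : Set (ℝ × ℝ)) (φ : ℝ × ℝ → F) : Prop where
  smooth : ContDiff ℝ ∞ φ
  compact : HasCompactSupport φ
  supp : tsupport φ ⊆ S

/-- `u ∈ L^∞((0,T) × Ω, ℝ^m)` is a weak solution of `∂_t u + ∂_x f(u) = 0` with initial
data `u₀`. -/
structure IsWeakSolution {m : ℕ} (T : ℝ) (f : State m → State m)
    (u₀ : ℝ → State m) (u : ℝ × ℝ → State m) : Prop where
  memLp : MemLp u ∞ (volume.restrict (cyl T))
  weak : ∀ φ : ℝ × ℝ → State m, IsTest (Iio T ×ˢ Ioo (0 : ℝ) 1) φ →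
    (∫ z in cyl T, (inner ℝ (dt φ z) (u z) + inner ℝ (dx φ z) (f (u z))))
      + ∫ x in Ioo (0 : ℝ) 1, inner ℝ (u₀ x) (φ (0, x)) = 0

/-- `u` is an entropy solution of `∂_t u + ∂_x f(u) = 0` with initial data `u₀`, with
respect to the entropy/entropy-flux pair `(η, q)`. -/
structure IsEntropySolution {m : ℕ} (T : ℝ) (f : State m → State m)
    (η q : State m → ℝ) (u₀ : ℝ → State m) (u : ℝ × ℝ → State m) : Prop
    extends IsWeakSolution T f u₀ u where
  entropy : ∀ Φ : ℝ × ℝ → ℝ, IsTest (Iio T ×ˢ Ioo (0 : ℝ) 1) Φ →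
    (∀ z ∈ Ico (0 : ℝ) T ×ˢ Ioo (0 : ℝ) 1, 0 ≤ Φ z) →
    0 ≤ (∫ z in cyl T, (dt Φ z * η (u z) + dx Φ z * q (u z)))
      + ∫ x in Ioo (0 : ℝ) 1, Φ (0, x) * η (u₀ x)

/-- The linear flux `f(v) = B v`. -/
noncomputable def linFlux {m : ℕ} (B : Matrix (Fin m) (Fin m) ℝ) (v : State m) : State m :=
  Matrix.toEuclideanLin B v

/-- The quadratic entropy `η(v) = ½ |v|²`. -/
noncomputable def quadEntropy {m : ℕ} (v : State m) : ℝ := 1 / 2 * ‖v‖ ^ 2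

/-- The entropy flux `q(v) = ½ v · B v`. -/
noncomputable def quadEntropyFlux {m : ℕ} (B : Matrix (Fin m) (Fin m) ℝ) (v : State m) : ℝ :=
  1 / 2 * inner ℝ v (linFlux B v)

/-- The bounded function `u` attains the data `g` on the incoming characteristics of
`∂_t u + diag(b) ∂_x u = 0`, in the sense of weak (normal) traces: for `b_i > 0` the flux
`b_i u_i` has trace `b_i g_i` at the left end `x = 0`, for `b_i < 0` it has trace `b_i g_i` at
the right end `x = 1`. The test functions need not vanish at the end in question; they vanish
near `t = 0`, near `t = T` and near the other end. Nothing is prescribed at the outgoing ends,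
nor for `b_i = 0`. -/
structure AttainsIncoming {m : ℕ} (T : ℝ) (b : Fin m → ℝ) (g : ℝ → State m)
    (u : ℝ × ℝ → State m) : Prop where
  left : ∀ i, 0 < b i → ∀ φ : ℝ × ℝ → ℝ, IsTest (Ioo 0 T ×ˢ Iio (1 : ℝ)) φ →
    (∫ z in cyl T, (dt φ z * u z i + dx φ z * (b i * u z i)))
      + ∫ t in Ioo 0 T, φ (t, 0) * (b i * g t i) = 0
  right : ∀ i, b i < 0 → ∀ φ : ℝ × ℝ → ℝ, IsTest (Ioo 0 T ×ˢ Ioi (0 : ℝ)) φ →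
    (∫ z in cyl T, (dt φ z * u z i + dx φ z * (b i * u z i)))
      - ∫ t in Ioo 0 T, φ (t, 1) * (b i * g t i) = 0

/-- `v` (continuous up to the boundary, representing an element of `W^{1,∞}((0,T) × Ω, ℝ^m)`)
is a Lipschitz strong solution of `∂_t v + diag(b) ∂_x v = r` with initial data `v₀` and with
data `g` on the incoming characteristics. By Rademacher's theorem the derivatives exist almost
everywhere. -/
structure IsLipschitzSolution {m : ℕ} (T : ℝ) (b : Fin m → ℝ) (r : ℝ × ℝ → State m)
    (v₀ : ℝ → State m) (g : ℝ → State m) (v : ℝ × ℝ → State m) : Prop where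
  lipschitz : ∃ K : ℝ≥0, LipschitzOnWith K v (Icc 0 T ×ˢ Icc (0 : ℝ) 1)
  equation : ∀ᵐ z ∂(volume.restrict (cyl T)),
    dt v z + linFlux (Matrix.diagonal b) (dx v z) = r z
  initial : ∀ x ∈ Ioo (0 : ℝ) 1, v (0, x) = v₀ x
  left : ∀ i, 0 < b i → ∀ t ∈ Ioo 0 T, v (t, 0) i = g t i
  right : ∀ i, b i < 0 → ∀ t ∈ Ioo 0 T, v (t, 1) i = g t i

/-- The norm of `L^2(Ω, ℝ^m)`. -/
noncomputable def normL2 {m : ℕ} (w : ℝ → State m) : ℝ≥0∞ :=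
  eLpNorm w 2 (volume.restrict (Ioo (0 : ℝ) 1))

/-- The norm of `L^∞(0,t; L^2(Ω, ℝ^m))`. -/
noncomputable def normLinfL2 {m : ℕ} (t : ℝ) (w : ℝ × ℝ → State m) : ℝ≥0∞ :=
  essSup (fun s => normL2 (fun x => w (s, x))) (volume.restrict (Ioo 0 t))

/-- The norm of `L^1(0,t; L^2(Ω, ℝ^m))`. -/
noncomputable def normL1L2 {m : ℕ} (t : ℝ) (w : ℝ × ℝ → State m) : ℝ≥0∞ :=
  ∫⁻ s in Ioo 0 t, normL2 (fun x => w (s, x))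

end LinHyp

/-! Since `B` is diagonal, each component solves a scalar transport equation, and a bounded weak
solution of it is constant along characteristics: traced back, `u_i` takes the value of `u₀` if the
characteristic reaches `t = 0` in `(0,1)`, and of `g` if it enters through the inflow side
(`transport_ae_eq`, `inflow_ae_eq`). The first case is a duality argument: the backward equation
with a given smooth right-hand side has a test function as solution. The second is the first with
time and space exchanged.

The Lipschitz function `v` changes along a characteristic by at most the integral of its residual.
As `u` and `v` share the incoming data, `|u_i - v_i|` at `(t, x)` is at most the initial error at
the foot plus the integral of the residual along the characteristic (`enorm_sub_le_duhamel`).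
Minkowski's inequality and translation invariance of the `L²` norm bound the error at time `t` by
`‖u₀ - v₀‖ + ‖r‖_{L¹L²}` (`normL2_sub_le`), and squaring gives the claim. -/

namespace LinHyp

/-! ### Test functions solving the backward transport equation -/

/-- Integrating a test function over translates of a segment gives a smooth function. -/
lemma contDiff_integral_segment {f : ℝ × ℝ → ℝ} (hf : ContDiff ℝ ∞ f)
    (hc : HasCompactSupport f) (e : ℝ × ℝ) {M : ℝ} (hM : 0 ≤ M) :
    ContDiff ℝ ∞ (fun z => ∫ τ in (0 : ℝ)..M, f (z + τ • e)) := by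
  have hmeas : Measurable (fun τ : ℝ => -(τ • e)) := by fun_prop
  -- The integral is the convolution of `f` with the image of Lebesgue measure on `(0, M]` under `τ
  -- ↦ -τ • e`, so it inherits the smoothness of `f`.
  have h := hc.contDiff_convolution_right (n := ⊤) (f := fun _ => (1 : ℝ))
    (μ := (volume.restrict (Ioc 0 M)).map (fun τ : ℝ => -(τ • e)))
    (ContinuousLinearMap.mul ℝ ℝ) (locallyIntegrable_const 1) hf
  convert h using 1
  ext z
  rw [convolution, integral_map hmeas.aemeasurable, intervalIntegral.integral_of_le hM]
  · simp
  · have := hf.continuous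
    exact Continuous.aestronglyMeasurable (by fun_prop)

/-- The derivative along the segment of the integral over translates of that segment. -/
lemma fderiv_integral_segment {f : ℝ × ℝ → ℝ} (hf : ContDiff ℝ ∞ f)
    (hc : HasCompactSupport f) (e z : ℝ × ℝ) {M : ℝ} (hM : 0 ≤ M) :
    fderiv ℝ (fun z => ∫ τ in (0 : ℝ)..M, f (z + τ • e)) z e = f (z + M • e) - f z := by
  have hd : DifferentiableAt ℝ (fun z => ∫ τ in (0 : ℝ)..M, f (z + τ • e)) z :=
    ((contDiff_integral_segment hf hc e hM).differentiable (by simp)) z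
  have h1 : HasDerivAt (fun h : ℝ => ∫ τ in (0 : ℝ)..M, f ((z + h • e) + τ • e))
      (fderiv ℝ (fun z => ∫ τ in (0 : ℝ)..M, f (z + τ • e)) z e) 0 := by
    have hl : HasDerivAt (fun h : ℝ => z + h • e) e 0 := by
      simpa using ((hasDerivAt_id (0 : ℝ)).smul_const e).const_add z
    have hd' : HasFDerivAt (fun z => ∫ τ in (0 : ℝ)..M, f (z + τ • e))
      (fderiv ℝ (fun z => ∫ τ in (0 : ℝ)..M, f (z + τ • e)) z) (z + (0 : ℝ) • e) := by
      simpa using hd.hasFDerivAt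
    exact hd'.comp_hasDerivAt (0 : ℝ) hl
  have hcont : Continuous (fun τ : ℝ => f (z + τ • e)) := by
    have := hf.continuous
    fun_prop
  -- Moving the base point by `h • e` only shifts the interval of integration to `[h, M + h]`, so
  -- the fundamental theorem of calculus applies at both ends.
  have h2 : HasDerivAt (fun h : ℝ => ∫ τ in (0 : ℝ)..M, f ((z + h • e) + τ • e))
      (f (z + M • e) - f z) 0 := by
    have hF : ∀ a : ℝ, HasDerivAt (fun x => ∫ τ in (0 : ℝ)..x, f (z + τ • e))
        (f (z + a • e)) a := fun a =>
      intervalIntegral.integral_hasDerivAt_right (hcont.intervalIntegrable _ _)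
        hcont.aestronglyMeasurable.stronglyMeasurableAtFilter hcont.continuousAt
    have hA : HasDerivAt (fun h : ℝ => ∫ τ in (0 : ℝ)..(M + h), f (z + τ • e))
        (f (z + M • e)) 0 := by
      have := hF (M + 0)
      simpa using this.comp_const_add M 0
    have hB := hF 0
    have := hA.sub hB
    simp only [zero_smul, add_zero] at this
    refine this.congr_of_eventuallyEq (Filter.Eventually.of_forall fun h => ?_)
    have e1 : ∀ τ : ℝ, z + h • e + τ • e = z + (τ + h) • e := fun τ => by module
    simp only [e1, Pi.sub_apply]
    rw [intervalIntegral.integral_comp_add_right (fun τ => f (z + τ • e)) h, zero_add,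
      intervalIntegral.integral_interval_sub_left (hcont.intervalIntegrable _ _)
        (hcont.intervalIntegrable _ _)]
  exact h1.unique h2

/-- The shear along the characteristics of speed `c` preserves the Lebesgue measure. -/
lemma measurePreserving_shear (c : ℝ) :
    MeasurePreserving (fun p : ℝ × ℝ => (p.1, p.2 + c * p.1)) volume volume := by
  refine MeasurePreserving.skew_product (g := fun s y => y + c * s) (MeasurePreserving.id volume)
    (by fun_prop) (ae_of_all _ fun s => ?_)
  exact (measurePreserving_add_right volume (c * s)).map_eq

lemma fderiv_apply_one_speed (φ : ℝ × ℝ → ℝ) (c : ℝ) (z : ℝ × ℝ) :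
    fderiv ℝ φ z (1, c) = dt φ z + c * dx φ z := by
  have : ((1, c) : ℝ × ℝ) = (1, 0) + c • (0, 1) := by ext <;> simp
  rw [this, map_add, map_smul, dt, dx, smul_eq_mul]

/-- A compact set of points of a rectangle whose characteristics start on the bottom side stays
away from the boundary of the set of all such points. -/
lemma exists_margin {A B c : ℝ} {K : Set (ℝ × ℝ)} (hK : IsCompact K)
    (hKQ : ∀ z ∈ K, z ∈ Ioo 0 A ×ˢ Ioo 0 B ∧ z.2 - c * z.1 ∈ Ioo 0 B) :
    ∃ δ > 0, ∀ z ∈ K, z.1 ≤ A - δ ∧ z.2 ∈ Icc δ (B - δ) ∧ z.2 - c * z.1 ∈ Icc δ (B - δ) := by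
  rcases K.eq_empty_or_nonempty with rfl | hne
  · exact ⟨1, one_pos, by simp⟩
  -- `δ` is the least slack over `K` in the strict inequalities. The slack in `0 < z.1` is left out,
  -- since the final test function need not vanish near `t = 0`.
  obtain ⟨w, hw, hmin⟩ := hK.exists_isMinOn hne
    (f := fun z : ℝ × ℝ => min (A - z.1) (min (min z.2 (B - z.2))
      (min (z.2 - c * z.1) (B - (z.2 - c * z.1))))) (by fun_prop)
  refine ⟨min (A - w.1) (min (min w.2 (B - w.2))
      (min (w.2 - c * w.1) (B - (w.2 - c * w.1)))), ?_, fun z hz => ?_⟩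
  rotate_left
  · have h := hmin hz
    simp only [mem_ofPred_eq] at h
    generalize min (A - w.1) (min (min w.2 (B - w.2))
      (min (w.2 - c * w.1) (B - (w.2 - c * w.1)))) = δ at h ⊢
    simp only [le_min_iff] at h
    obtain ⟨h1, ⟨h2, h3⟩, h4, h5⟩ := h
    exact ⟨by linarith, ⟨h2, by linarith⟩, h4, by linarith⟩
  · obtain ⟨⟨⟨_, h2⟩, h3, h4⟩, h5, h6⟩ := hKQ w hw
    simp only [gt_iff_lt, lt_min_iff]
    exact ⟨by linarith, ⟨h3, by linarith⟩, h5, by linarith⟩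

/-- The backward transport equation with right-hand side `f` is solved by a test function. -/
lemma exists_test_primitive {A B c : ℝ} (hA : 0 < A) {f : ℝ × ℝ → ℝ}
    (hf : ContDiff ℝ ∞ f) (hc : HasCompactSupport f)
    (hsupp : ∀ z ∈ tsupport f, z ∈ Ioo 0 A ×ˢ Ioo 0 B ∧ z.2 - c * z.1 ∈ Ioo 0 B) :
    ∃ φ : ℝ × ℝ → ℝ, IsTest (Iio A ×ˢ Ioo 0 B) φ ∧
      (∀ z, 0 < z.1 → dt φ z + c * dx φ z = f z) ∧
      ∀ y, φ (0, y) = -∫ τ in (0 : ℝ)..(A + 1), f (τ, y + c * τ) := by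
  obtain ⟨δ, hδ, hK⟩ := exists_margin hc.isCompact hsupp
  -- The time cutoff below lives on `t > -2ε`; with this `ε` a characteristic drifts by at most `δ /
  -- 2` over that extra time, so the support stays inside `(0, B)`.
  set ε : ℝ := min (1 / 2) (δ / (4 * (|c| + 1))) with hε
  have hε0 : 0 < ε := by positivity
  have hε1 : 2 * ε ≤ 1 := by linarith [min_le_left (1 / 2) (δ / (4 * (|c| + 1)))]
  have hεc : |c| * (2 * ε) ≤ δ / 2 := by
    have h1 : ε ≤ δ / (4 * (|c| + 1)) := min_le_right _ _
    rw [le_div_iff₀ (by positivity)] at h1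
    nlinarith [abs_nonneg c]
  have hM : 0 ≤ A + 1 := by linarith
  set G : ℝ × ℝ → ℝ := fun z => ∫ τ in (0 : ℝ)..(A + 1), f (z + τ • ((1, c) : ℝ × ℝ)) with hG
  have hGs : ContDiff ℝ ∞ G := contDiff_integral_segment hf hc (1, c) hM
  set φ : ℝ × ℝ → ℝ := fun z => -(Real.smoothTransition (2 + z.1 / ε) * G z) with hφ
  have hbox : Function.support φ ⊆ Icc (-(2 * ε)) (A - δ) ×ˢ Icc (δ / 2) (B - δ / 2) := by
    intro z hz
    have hz' : Real.smoothTransition (2 + z.1 / ε) ≠ 0 ∧ G z ≠ 0 := by simpa [hφ] using hz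
    obtain ⟨hz1, hz2⟩ := hz'
    have h1 : 0 < 2 + z.1 / ε := by
      by_contra h
      exact hz1 (Real.smoothTransition.zero_of_nonpos (not_lt.1 h))
    have h1' : -(2 * ε) < z.1 := by
      have : 0 < (2 + z.1 / ε) * ε := mul_pos h1 hε0
      rw [add_mul, div_mul_cancel₀ _ hε0.ne'] at this
      linarith
    obtain ⟨τ, hτ, hτf⟩ : ∃ τ ∈ uIcc 0 (A + 1), f (z + τ • ((1, c) : ℝ × ℝ)) ≠ 0 := by
      by_contra h
      push Not at h
      apply hz2
      rw [hG]
      simp only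
      rw [intervalIntegral.integral_congr (g := fun _ => (0 : ℝ)) h]
      simp
    rw [uIcc_of_le hM] at hτ
    obtain ⟨k1, ⟨k2, k3⟩, k4, k5⟩ := hK _ (subset_tsupport _ hτf)
    simp only [Prod.fst_add, Prod.smul_fst, Prod.snd_add, Prod.smul_snd, smul_eq_mul, mul_one]
      at k1 k2 k3 k4 k5
    refine ⟨⟨h1'.le, by linarith [hτ.1]⟩, ?_⟩
    rcases le_or_gt 0 z.1 with h0 | h0
    -- For `t ≥ 0` the position lies between the foot at time `0` and the later point in the support
    -- of `f`, both in `[δ, B - δ]`.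
    · rcases le_total 0 c with hc0 | hc0
      · constructor <;> nlinarith [mul_nonneg hc0 h0, mul_nonneg hc0 hτ.1]
      · constructor <;> nlinarith [mul_nonneg (neg_nonneg.2 hc0) h0,
          mul_nonneg (neg_nonneg.2 hc0) hτ.1]
    · have : |c * z.1| ≤ δ / 2 := by
        rw [abs_mul, abs_of_neg h0]
        refine le_trans ?_ hεc
        gcongr
        linarith
      obtain ⟨a1, a2⟩ := abs_le.1 this
      constructor <;> nlinarith
  have hcl : tsupport φ ⊆ Icc (-(2 * ε)) (A - δ) ×ˢ Icc (δ / 2) (B - δ / 2) :=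
    closure_minimal hbox (isClosed_Icc.prod isClosed_Icc)
  refine ⟨φ, ⟨?_, ?_, ?_⟩, ?_, ?_⟩
  · have : ContDiff ℝ ∞ (fun z : ℝ × ℝ => Real.smoothTransition (2 + z.1 / ε)) :=
      Real.smoothTransition.contDiff.comp (by fun_prop)
    exact (this.mul hGs).neg
  · exact HasCompactSupport.of_support_subset_isCompact (isCompact_Icc.prod isCompact_Icc) hbox
  · refine hcl.trans (prod_mono (fun s hs => ?_) (fun s hs => ?_))
    · exact lt_of_le_of_lt hs.2 (by linarith)
    · exact ⟨by linarith [hs.1], by linarith [hs.2]⟩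
  · intro z hz
    have hloc : φ =ᶠ[nhds z] fun z => -G z := by
      filter_upwards [(isOpen_lt continuous_const continuous_fst).mem_nhds hz] with w hw
      have h0 : 0 < w.1 / ε := div_pos hw hε0
      simp only [hφ]
      rw [Real.smoothTransition.one_of_one_le (by linarith), one_mul]
    have hfar : f (z + (A + 1) • ((1, c) : ℝ × ℝ)) = 0 := by
      by_contra h
      have := (hK _ (subset_tsupport _ h)).1
      simp at this
      linarith
    rw [← fderiv_apply_one_speed, hloc.fderiv_eq, fderiv_fun_neg]
    simp only [neg_apply]
    rw [hG, fderiv_integral_segment hf hc _ _ hM, hfar]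
    ring
  · intro y
    simp only [hφ, hG]
    rw [Real.smoothTransition.one_of_one_le (by norm_num), one_mul]
    congr 2
    ext τ
    simp [mul_comm]

/-! ### Weak solutions are constant along characteristics -/

/-- Bounded weak solutions of `∂_t U + c ∂_x U = 0` on `(0,A) × (0,B)` with data `h` at `t = 0`
are constant along the characteristics that start on the bottom side. -/
theorem transport_ae_eq {A B c : ℝ} (hA : 0 < A) {U : ℝ × ℝ → ℝ} {h : ℝ → ℝ}
    (hU : MemLp U ∞ (volume.restrict (Ioo 0 A ×ˢ Ioo 0 B)))
    (hh : IntegrableOn h (Ioo 0 B))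
    (hweak : ∀ φ : ℝ × ℝ → ℝ, IsTest (Iio A ×ˢ Ioo 0 B) φ →
      (∫ z in Ioo 0 A ×ˢ Ioo 0 B, (dt φ z * U z + dx φ z * (c * U z)))
        + ∫ y in Ioo 0 B, φ (0, y) * h y = 0) :
    ∀ᵐ z : ℝ × ℝ, z ∈ Ioo 0 A ×ˢ Ioo 0 B → z.2 - c * z.1 ∈ Ioo 0 B →
      U z = h (z.2 - c * z.1) := by
  set D : Set (ℝ × ℝ) := Ioo 0 A ×ˢ Ioo 0 B with hD
  have hDm : MeasurableSet D := measurableSet_Ioo.prod measurableSet_Ioo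
  have hDfin : IsFiniteMeasure (volume.restrict D) := by
    refine ⟨?_⟩
    rw [Measure.restrict_apply_univ, hD, Measure.volume_eq_prod, Measure.prod_prod]
    simp [ENNReal.mul_lt_top_iff]
  set H : ℝ → ℝ := (Ioo 0 B).indicator h with hH
  have hHint : Integrable H := hh.integrable_indicator measurableSet_Ioo
  set χ : ℝ → ℝ := (Ioo 0 A).indicator (fun _ => 1) with hχ
  have hχint : Integrable χ := by
    rw [hχ, integrable_indicator_iff measurableSet_Ioo]
    exact integrableOn_const (by simp)
  have hW : Integrable (fun p : ℝ × ℝ => χ p.1 * H p.2) := hχint.mul_prod hHint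
  -- `J` is the expected solution, extended by zero; it is a product function composed with a shear,
  -- hence integrable.
  set J : ℝ × ℝ → ℝ := fun z => χ z.1 * H (z.2 + -c * z.1) with hJ
  have hJint : Integrable J :=
    (measurePreserving_shear (-c)).integrable_comp_of_integrable hW
  have hUint : Integrable (D.indicator U) :=
    (integrable_indicator_iff hDm).2 (hU.integrable (by simp))
  set Q : Set (ℝ × ℝ) := {z | z ∈ D ∧ z.2 - c * z.1 ∈ Ioo 0 B} with hQ
  have hQo : IsOpen Q := by
    refine (isOpen_Ioo.prod isOpen_Ioo).inter (isOpen_Ioo.preimage ?_)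
    fun_prop
  have key := hQo.ae_eq_zero_of_integral_contDiff_smul_eq_zero (μ := volume)
    (f := fun z => D.indicator U z - J z) ((hUint.sub hJint).locallyIntegrable.locallyIntegrableOn _)
    ?_
  · filter_upwards [key] with z hz h1 h2
    have := hz ⟨h1, h2⟩
    have e1 : z.2 + -c * z.1 = z.2 - c * z.1 := by ring
    simp only [hJ, hχ, hH, e1, indicator_of_mem h1, indicator_of_mem h2, indicator_of_mem h1.1]
      at this
    linarith
  intro f hf hc hs
  have hfc : Continuous f := hf.continuous
  obtain ⟨Cf, hCf⟩ := hc.exists_bound_of_continuous hfc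
  obtain ⟨φ, hφ, hφd, hφ0⟩ := exists_test_primitive hA hf hc hs
  have hz0 : ∀ z, f z ≠ 0 → z ∈ D := fun z hz => (hs (subset_tsupport _ hz)).1
  have h1 : ∫ z in D, (dt φ z * U z + dx φ z * (c * U z)) = ∫ z, f z * D.indicator U z := by
    have : ∀ z, f z * D.indicator U z = D.indicator (fun z => f z * U z) z := fun z => by
      by_cases hz : z ∈ D <;> simp [hz]
    simp only [this]
    rw [integral_indicator hDm]
    refine setIntegral_congr_fun hDm fun z hz => ?_
    rw [← hφd z hz.1.1]
    ring
  -- The value of `φ` at `t = 0` is minus the integral of `f` along the characteristic, so shearing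
  -- and Fubini turn the initial term into the pairing of `f` with `J`.
  have h2 : ∫ y in Ioo 0 B, φ (0, y) * h y = -∫ z, f z * J z := by
    have hS := measurePreserving_shear c
    have hfJ : Integrable (fun z => f z * J z) :=
      hJint.bdd_mul hfc.aestronglyMeasurable (ae_of_all _ hCf)
    have e1 : ∫ z, f z * J z = ∫ p : ℝ × ℝ, f (p.1, p.2 + c * p.1) * (χ p.1 * H p.2) := by
      have hae : AEStronglyMeasurable (fun z => f z * J z)
          (Measure.map (fun p : ℝ × ℝ => (p.1, p.2 + c * p.1)) volume) := by
        rw [hS.map_eq]; exact hfJ.aestronglyMeasurable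
      conv_lhs => rw [← hS.map_eq]
      rw [integral_map hS.measurable.aemeasurable hae]
      refine integral_congr_ae (ae_of_all _ fun p => ?_)
      simp only [hJ]
      congr 3
      ring
    have hint : Integrable (fun p : ℝ × ℝ => f (p.1, p.2 + c * p.1) * (χ p.1 * H p.2)) :=
      hW.bdd_mul (Continuous.aestronglyMeasurable (by fun_prop)) (ae_of_all _ fun p => hCf _)
    rw [e1, Measure.volume_eq_prod, integral_prod_symm _ hint, ← integral_neg,
      ← integral_indicator measurableSet_Ioo]
    refine integral_congr_ae (ae_of_all _ fun y => ?_)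
    have e2 : ∀ s, f (s, y + c * s) * (χ s * H y)
        = (Ioc 0 (A + 1)).indicator (fun s => f (s, y + c * s)) s * H y := fun s => by
      by_cases hf0 : f (s, y + c * s) = 0
      · simp [hf0, indicator_apply]
      · have := (hz0 _ hf0).1
        have h3 : s ∈ Ioc 0 (A + 1) := ⟨this.1, by linarith [this.2]⟩
        simp only at this
        rw [indicator_of_mem h3, hχ, indicator_of_mem this, one_mul]
    simp only [e2]
    rw [integral_mul_const, integral_indicator measurableSet_Ioc,
      ← intervalIntegral.integral_of_le (by linarith), ← neg_mul, ← hφ0, hH]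
    by_cases hy : y ∈ Ioo 0 B <;> simp [hy]
  have h3 := hweak φ hφ
  rw [h1, h2] at h3
  simp only [smul_eq_mul, mul_sub]
  rw [integral_sub (hUint.bdd_mul hfc.aestronglyMeasurable (ae_of_all _ hCf))
    (hJint.bdd_mul hfc.aestronglyMeasurable (ae_of_all _ hCf))]
  linarith

/-- The pair `(a, κ)` encodes an end of `(0,1)` and its inward direction; both ends are then handled
by one argument. -/
lemma measurePreserving_reflect {a κ : ℝ} (hκ : (a = 0 ∧ κ = 1) ∨ (a = 1 ∧ κ = -1)) :
    MeasurePreserving (fun x : ℝ => a + κ * x) volume volume := by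
  rcases hκ with ⟨rfl, rfl⟩ | ⟨rfl, rfl⟩
  · simpa using! MeasurePreserving.id (volume : Measure ℝ)
  · simpa using!
      (measurePreserving_add_left volume (1 : ℝ)).comp (Measure.measurePreserving_neg volume)

/-- A bounded weak solution with data `g` on the inflow side `x = a` is constant along the
characteristics that start there. -/
theorem inflow_ae_eq {T a κ b : ℝ} (hκ : (a = 0 ∧ κ = 1) ∨ (a = 1 ∧ κ = -1)) (hb : 0 < κ * b)
    {U : ℝ × ℝ → ℝ} {g : ℝ → ℝ} (hU : MemLp U ∞ (volume.restrict (cyl T)))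
    (hg : IntegrableOn g (Ioo 0 T))
    (hweak : ∀ φ : ℝ × ℝ → ℝ, IsTest (Ioo 0 T ×ˢ {x | a + κ * x < 1}) φ →
      (∫ z in cyl T, (dt φ z * U z + dx φ z * (b * U z)))
        + κ * ∫ t in Ioo 0 T, φ (t, a) * (b * g t) = 0) :
    ∀ᵐ z : ℝ × ℝ, z ∈ cyl T → z.1 - (z.2 - a) / b ∈ Ioo 0 T →
      U z = g (z.1 - (z.2 - a) / b) := by
  have hκκ : κ * κ = 1 := by rcases hκ with ⟨_, rfl⟩ | ⟨_, rfl⟩ <;> norm_num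
  have haa : a + κ * a = 0 := by rcases hκ with ⟨rfl, rfl⟩ | ⟨rfl, rfl⟩ <;> norm_num
  have hinv : ∀ x, a + κ * (a + κ * x) = x := fun x => by
    linear_combination haa + x * hκκ
  have hIoo : ∀ x, a + κ * x ∈ Ioo (0 : ℝ) 1 ↔ x ∈ Ioo (0 : ℝ) 1 := fun x => by
    rcases hκ with ⟨rfl, rfl⟩ | ⟨rfl, rfl⟩
    · simp
    · constructor <;> rintro ⟨h1, h2⟩ <;> constructor <;> linarith
  have hρ := measurePreserving_reflect hκ
  have hb0 : b ≠ 0 := by rintro rfl; simp at hb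
  -- `σ` lets the distance from the inflow side play the role of time, so that the boundary data
  -- become initial data.
  set σ : ℝ × ℝ → ℝ × ℝ := fun p => (p.2, a + κ * p.1) with hσ
  set τ : ℝ × ℝ → ℝ × ℝ := fun z => (a + κ * z.2, z.1) with hτ
  have hστ : ∀ z, σ (τ z) = z := fun z => by simp [hσ, hτ, hinv]
  have hτσ : ∀ z, τ (σ z) = z := fun z => by simp [hσ, hτ, hinv]
  have hσm : MeasurePreserving σ volume volume :=
    ((MeasurePreserving.id (volume : Measure ℝ)).prod hρ).comp Measure.measurePreserving_swap
  have hτm : MeasurePreserving τ volume volume :=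
    (hρ.prod (MeasurePreserving.id (volume : Measure ℝ))).comp Measure.measurePreserving_swap
  have hσe : MeasurableEmbedding σ := hσm.measurable.measurableEmbedding
    (Function.LeftInverse.injective hτσ)
  have hpre : σ ⁻¹' (cyl T) = Ioo (0 : ℝ) 1 ×ˢ Ioo 0 T := by
    ext p
    simp only [cyl, hσ, mem_preimage, mem_prod, hIoo]
    exact and_comm
  -- With `κ * b` factored out of the weak identity, the speed in the exchanged variables is `1 / (κ
  -- * b) = κ / b`.
  have key := transport_ae_eq (A := 1) (B := T) (c := κ / b) one_pos (U := fun p => U (σ p))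
    (h := g) ?_ hg ?_
  · filter_upwards [hτm.quasiMeasurePreserving.ae key] with z hz h1 h2
    have e1 : z.1 - κ / b * (a + κ * z.2) = z.1 - (z.2 - a) / b := by
      field_simp
      linear_combination -haa - z.2 * hκκ
    have h3 : τ z ∈ Ioo (0 : ℝ) 1 ×ˢ Ioo 0 T := by
      rw [← hpre, mem_preimage, hστ]; exact h1
    have := hz h3
    simp only [hστ] at this
    simp only [hτ, e1] at this
    exact this h2
  · have := hU.comp_measurePreserving (hσm.restrict_preimage_emb hσe (cyl T))
    rwa [hpre] at this
  intro ψ hψ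
  set L : ℝ × ℝ →L[ℝ] ℝ × ℝ :=
    (κ • ContinuousLinearMap.snd ℝ ℝ ℝ).prod (ContinuousLinearMap.fst ℝ ℝ ℝ) with hL
  have hτd : ∀ z, HasFDerivAt τ L z := fun z =>
    ((hasFDerivAt_snd.const_mul κ).const_add a).prodMk hasFDerivAt_fst
  have hτc : Continuous τ := by fun_prop
  have hσc : Continuous σ := by fun_prop
  have hψd : ∀ z, HasFDerivAt (fun z => ψ (τ z)) ((fderiv ℝ ψ (τ z)).comp L) z := fun z =>
    ((hψ.smooth.differentiable (by simp)) (τ z)).hasFDerivAt.comp z (hτd z)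
  have hdt : ∀ z, dt (fun z => ψ (τ z)) z = dx ψ (τ z) := fun z => by
    rw [dt, (hψd z).fderiv]
    simp [hL, dx]
  have hdx : ∀ z, dx (fun z => ψ (τ z)) z = κ * dt ψ (τ z) := fun z => by
    have : L (0, 1) = κ • ((1, 0) : ℝ × ℝ) := by simp [hL]
    rw [dx, (hψd z).fderiv, ContinuousLinearMap.comp_apply, this, map_smul, smul_eq_mul, dt]
  let e : ℝ × ℝ ≃ₜ ℝ × ℝ :=
    { toFun := τ, invFun := σ, left_inv := hστ, right_inv := hτσ,
      continuous_toFun := hτc, continuous_invFun := hσc }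
  have htest : IsTest (Ioo 0 T ×ˢ {x | a + κ * x < 1}) (fun z => ψ (τ z)) := by
    refine ⟨hψ.smooth.comp (by fun_prop), hψ.compact.comp_homeomorph e, ?_⟩
    refine (tsupport_comp_subset_preimage ψ hτc).trans fun z hz => ?_
    have := hψ.supp hz
    exact ⟨this.2, this.1⟩
  have h1 := hweak _ htest
  simp only [hdt, hdx] at h1
  rw [← hσm.setIntegral_preimage_emb hσe, hpre] at h1
  simp only [hτσ] at h1
  have h2 : ∀ t, ψ (τ (t, a)) * (b * g t) = b * (ψ (0, t) * g t) := fun t => by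
    simp only [hτ, haa]; ring
  simp only [h2] at h1
  rw [integral_const_mul] at h1
  have h3 : ∀ z, dx ψ z * U (σ z) + κ * dt ψ z * (b * U (σ z))
      = (κ * b) * (dt ψ z * U (σ z) + dx ψ z * (κ / b * U (σ z))) := fun z => by
    field_simp
    linear_combination -(dx ψ z * U (σ z)) * hκκ
  simp only [h3] at h1
  rw [integral_const_mul, ← mul_assoc, ← mul_add] at h1
  exact (mul_eq_zero.1 h1).resolve_left hb.ne'

/-! ### Components of the system -/

lemma linFlux_diagonal_apply {m : ℕ} (b : Fin m → ℝ) (v : State m) (i : Fin m) :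
    linFlux (Matrix.diagonal b) v i = b i * v i := by
  simp [linFlux, Matrix.mulVec_diagonal]

lemma memLp_component {m : ℕ} {α : Type*} [MeasurableSpace α] {μ : Measure α} {p : ℝ≥0∞}
    {f : α → State m} (hf : MemLp f p μ) (i : Fin m) : MemLp (fun x => f x i) p μ :=
  (EuclideanSpace.proj (𝕜 := ℝ) i : State m →L[ℝ] ℝ).comp_memLp' hf

/-- Testing the system with a scalar test function times the `i`-th basis vector isolates the scalar
equation of that component. -/
theorem IsWeakSolution.ae_eq_initial {m : ℕ} {T : ℝ} (hT : 0 < T) {b : Fin m → ℝ}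
    {u₀ : ℝ → State m} {u : ℝ × ℝ → State m}
    (hu₀ : MemLp u₀ ∞ (volume.restrict (Ioo (0 : ℝ) 1)))
    (hu : IsWeakSolution T (linFlux (Matrix.diagonal b)) u₀ u) (i : Fin m) :
    ∀ᵐ z : ℝ × ℝ, z ∈ cyl T → z.2 - b i * z.1 ∈ Ioo (0 : ℝ) 1 →
      u z i = u₀ (z.2 - b i * z.1) i := by
  refine transport_ae_eq (h := fun x => u₀ x i) hT (memLp_component hu.memLp i)
    ((memLp_component hu₀ i).integrable (by simp)) fun φ hφ => ?_
  set e : State m := EuclideanSpace.single i 1 with he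
  have hd : ∀ z, DifferentiableAt ℝ φ z := hφ.smooth.differentiable (by simp)
  have h := hu.weak (fun z => φ z • e) ⟨hφ.smooth.smul contDiff_const, hφ.compact.smul_right,
    (tsupport_smul_subset_left _ _).trans hφ.supp⟩
  have hdt : ∀ z, dt (fun z => φ z • e) z = dt φ z • e := fun z => by
    rw [dt, fderiv_smul_const (hd z)]; rfl
  have hdx : ∀ z, dx (fun z => φ z • e) z = dx φ z • e := fun z => by
    rw [dx, fderiv_smul_const (hd z)]; rfl
  have hin : ∀ (a : ℝ) (w : State m), inner ℝ (a • e) w = a * w i := fun a w => by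
    rw [inner_smul_left, he, EuclideanSpace.inner_single_left]; simp
  have hin' : ∀ (a : ℝ) (w : State m), inner ℝ w (a • e) = a * w i := fun a w => by
    rw [real_inner_comm, hin]
  simp only [hdt, hdx, hin, hin', linFlux_diagonal_apply] at h
  exact h

lemma integrableOn_component_of_lipschitz {m : ℕ} {T : ℝ} {g : ℝ → State m}
    (hg : ∃ K : ℝ≥0, LipschitzOnWith K g (Icc 0 T)) (i : Fin m) :
    IntegrableOn (fun t => g t i) (Ioo 0 T) := by
  obtain ⟨K, hK⟩ := hg
  have : ContinuousOn (fun t => g t i) (Icc 0 T) :=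
    (EuclideanSpace.proj (𝕜 := ℝ) i : State m →L[ℝ] ℝ).continuous.comp_continuousOn
      hK.continuousOn
  exact this.integrableOn_Icc.mono_set Ioo_subset_Icc_self

theorem AttainsIncoming.ae_eq_left {m : ℕ} {T : ℝ} {b : Fin m → ℝ} {g : ℝ → State m}
    {u : ℝ × ℝ → State m} (hu : MemLp u ∞ (volume.restrict (cyl T)))
    (hg : ∃ K : ℝ≥0, LipschitzOnWith K g (Icc 0 T)) (hub : AttainsIncoming T b g u)
    {i : Fin m} (hi : 0 < b i) :
    ∀ᵐ z : ℝ × ℝ, z ∈ cyl T → z.1 - z.2 / b i ∈ Ioo 0 T → u z i = g (z.1 - z.2 / b i) i := by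
  have := inflow_ae_eq (T := T) (a := 0) (κ := 1) (b := b i) (Or.inl ⟨rfl, rfl⟩)
    (by simpa using hi) (memLp_component hu i) (integrableOn_component_of_lipschitz hg i)
    fun φ hφ => ?_
  · simpa only [sub_zero] using this
  · have hS : {x : ℝ | 0 + 1 * x < 1} = Iio 1 := by ext; simp
    rw [hS] at hφ
    simpa only [one_mul] using hub.left i hi φ hφ

theorem AttainsIncoming.ae_eq_right {m : ℕ} {T : ℝ} {b : Fin m → ℝ} {g : ℝ → State m}
    {u : ℝ × ℝ → State m} (hu : MemLp u ∞ (volume.restrict (cyl T)))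
    (hg : ∃ K : ℝ≥0, LipschitzOnWith K g (Icc 0 T)) (hub : AttainsIncoming T b g u)
    {i : Fin m} (hi : b i < 0) :
    ∀ᵐ z : ℝ × ℝ, z ∈ cyl T → z.1 - (z.2 - 1) / b i ∈ Ioo 0 T →
      u z i = g (z.1 - (z.2 - 1) / b i) i := by
  refine inflow_ae_eq (T := T) (a := 1) (κ := -1) (b := b i) (Or.inr ⟨rfl, rfl⟩)
    (by linarith) (memLp_component hu i) (integrableOn_component_of_lipschitz hg i)
    fun φ hφ => ?_
  have hS : {x : ℝ | 1 + -1 * x < 1} = Ioi 0 := by ext; simp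
  rw [hS] at hφ
  simpa only [neg_one_mul, ← sub_eq_add_neg] using hub.right i hi φ hφ

/-! ### Lipschitz functions along characteristics -/

/-- The foot `x - c t` of the characteristic through `(t, x)` is a nonsingular map. -/
lemma quasiMeasurePreserving_foot (c : ℝ) :
    Measure.QuasiMeasurePreserving (fun z : ℝ × ℝ => z.2 - c * z.1) volume volume := by
  have h := (Measure.quasiMeasurePreserving_snd (μ := (volume : Measure ℝ))
    (ν := (volume : Measure ℝ))).comp (measurePreserving_shear (-c)).quasiMeasurePreserving
  convert h using 2 with z
  simp only [Function.comp]
  ring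

/-- Almost every property holds almost everywhere on almost every characteristic. -/
lemma ae_characteristic {p : ℝ × ℝ → Prop} (hp : ∀ᵐ z, p z) (c : ℝ) :
    ∀ᵐ z : ℝ × ℝ, ∀ᵐ s : ℝ, p (s, z.2 - c * (z.1 - s)) := by
  have h1 := ((measurePreserving_shear c).comp
    (Measure.measurePreserving_swap (μ := (volume : Measure ℝ))
      (ν := (volume : Measure ℝ)))).quasiMeasurePreserving.ae hp
  have h2 := Measure.ae_ae_of_ae_prod h1
  -- Fubini in the coordinates (foot, time) leaves a null set of bad feet, and its preimage is a
  -- null set of points.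
  filter_upwards [(quasiMeasurePreserving_foot c).ae h2] with z hz
  filter_upwards [hz] with s hs
  have e : z.2 - c * (z.1 - s) = z.2 - c * z.1 + c * s := by ring
  rw [e]
  exact hs

/-- The position at time `s` is a convex combination of a point of `[0,1]` and the interior point
`x`, with positive weight on `x`. -/
lemma characteristic_mem_Ioo {x c t α s : ℝ} (hx : x ∈ Ioo (0 : ℝ) 1)
    (hα : x - c * (t - α) ∈ Icc (0 : ℝ) 1) (hs : s ∈ Ioc α t) :
    x - c * (t - s) ∈ Ioo (0 : ℝ) 1 := by
  obtain ⟨h1, h2⟩ := hx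
  obtain ⟨h3, h4⟩ := hα
  obtain ⟨h5, h6⟩ := hs
  rcases lt_trichotomy c 0 with hc | rfl | hc
  · constructor <;> nlinarith [mul_pos (neg_pos.2 hc) (sub_pos.2 h5),
      mul_nonneg (neg_pos.2 hc).le (sub_nonneg.2 h6)]
  · simp [h1, h2]
  · constructor <;> nlinarith [mul_pos hc (sub_pos.2 h5), mul_nonneg hc.le (sub_nonneg.2 h6)]

/-- The oscillation of a Lipschitz function along almost every characteristic is controlled by
its derivative along the characteristic. -/
theorem enorm_sub_le_lintegral_characteristic {m : ℕ} {T : ℝ} {v : ℝ × ℝ → State m} {K : ℝ≥0}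
    (hv : LipschitzOnWith K v (Icc 0 T ×ˢ Icc (0 : ℝ) 1)) (c : ℝ) (i : Fin m) :
    ∀ᵐ z : ℝ × ℝ, z ∈ cyl T → ∀ α ∈ Icc 0 z.1, z.2 - c * (z.1 - α) ∈ Icc (0 : ℝ) 1 →
      ‖v z i - v (α, z.2 - c * (z.1 - α)) i‖ₑ ≤
        ∫⁻ s in Ioc α z.1, ‖dt v (s, z.2 - c * (z.1 - s)) i
          + c * dx v (s, z.2 - c * (z.1 - s)) i‖ₑ := by
  have hdiff : ∀ᵐ z : ℝ × ℝ, z ∈ cyl T → DifferentiableAt ℝ v z := by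
    have hsub : cyl T ⊆ Icc 0 T ×ˢ Icc (0 : ℝ) 1 := prod_mono Ioo_subset_Icc_self
      Ioo_subset_Icc_self
    filter_upwards [(hv.mono hsub).ae_differentiableWithinAt_of_mem (μ := volume)] with z hz hzc
    exact (hz hzc).differentiableAt ((isOpen_Ioo.prod isOpen_Ioo).mem_nhds hzc)
  -- The exceptional null set does not depend on `α`, so the starting time may later vary with `z`.
  filter_upwards [ae_characteristic hdiff c] with z hz hzc α hα hpos
  set γ : ℝ → ℝ × ℝ := fun s => (s, z.2 - c * (z.1 - s)) with hγ
  have hγz : γ z.1 = z := by simp [hγ]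
  have hin : ∀ s ∈ Ioc α z.1, γ s ∈ cyl T := fun s hs =>
    ⟨⟨hα.1.trans_lt hs.1, hs.2.trans_lt hzc.1.2⟩, characteristic_mem_Ioo hzc.2 hpos hs⟩
  have hmaps : MapsTo γ (uIcc α z.1) (Icc 0 T ×ˢ Icc (0 : ℝ) 1) := by
    intro s hs
    rw [uIcc_of_le hα.2] at hs
    rcases hs.1.eq_or_lt with rfl | h
    · exact ⟨⟨hα.1, hα.2.trans hzc.1.2.le⟩, hpos⟩
    · exact prod_mono Ioo_subset_Icc_self Ioo_subset_Icc_self (hin s ⟨h, hs.2⟩)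
  have hγd : ∀ s, HasDerivAt γ (1, c) s := fun s => by
    have h2 : HasDerivAt (fun s => z.2 - c * (z.1 - s)) c s := by
      simpa using (((hasDerivAt_id s).const_sub z.1).const_mul c).const_sub z.2
    exact (hasDerivAt_id s).prodMk h2
  obtain ⟨K', hK'⟩ : ∃ K' : ℝ≥0, LipschitzOnWith K' γ (uIcc α z.1) := by
    refine ⟨‖((1, c) : ℝ × ℝ)‖₊, LipschitzWith.lipschitzOnWith ?_⟩
    exact lipschitzWith_of_nnnorm_deriv_le (𝕜 := ℝ) (fun s => (hγd s).differentiableAt)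
      fun s => by rw [(hγd s).deriv]
  -- A component of `v` along a characteristic is Lipschitz, hence absolutely continuous, hence the
  -- integral of its derivative.
  have hac := (((EuclideanSpace.proj (𝕜 := ℝ) i : State m →L[ℝ] ℝ).lipschitz.comp_lipschitzOnWith
    (hv.comp hK' hmaps))).absolutelyContinuousOnInterval.integral_deriv_eq_sub
  have h1 : v z i - v (γ α) i = ∫ s in α..z.1,
      deriv ((EuclideanSpace.proj (𝕜 := ℝ) i : State m →L[ℝ] ℝ) ∘ (v ∘ γ)) s := by
    rw [hac]; simp [hγz]
  change ‖v z i - v (γ α) i‖ₑ ≤ _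
  rw [h1, intervalIntegral.integral_of_le hα.2]
  refine (enorm_integral_le_lintegral_enorm _).trans (le_of_eq ?_)
  refine lintegral_congr_ae ((ae_restrict_iff' measurableSet_Ioc).2 ?_)
  filter_upwards [hz] with s hs hsI
  have h2 := ((EuclideanSpace.proj (𝕜 := ℝ) i : State m →L[ℝ] ℝ).hasFDerivAt.comp_hasDerivAt s
    ((hs (hin s hsI)).hasFDerivAt.comp_hasDerivAt s (hγd s)))
  have h3 : ((1, c) : ℝ × ℝ) = (1, 0) + c • (0, 1) := by ext <;> simp
  rw [h2.deriv, h3, map_add, map_smul]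
  simp [dt, dx]

/-! ### Duhamel bound -/

/-- The residual of `v`, extended by zero outside the cylinder. -/
noncomputable def residual {m : ℕ} (T : ℝ) (b : Fin m → ℝ) (v : ℝ × ℝ → State m) :
    ℝ × ℝ → State m :=
  (cyl T).indicator fun z => dt v z + linFlux (Matrix.diagonal b) (dx v z)

/-- The residual replaces `r`, for which only an almost everywhere identity is known; `fderiv` is
measurable for every function `v`. -/
lemma measurable_residual {m : ℕ} (T : ℝ) (b : Fin m → ℝ) (v : ℝ × ℝ → State m) :
    Measurable (residual T b v) := by
  refine Measurable.indicator ?_ (measurableSet_Ioo.prod measurableSet_Ioo)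
  have h1 : Measurable (dt v) := measurable_fderiv_apply_const ℝ v (1, 0)
  have h2 : Measurable (dx v) := measurable_fderiv_apply_const ℝ v (0, 1)
  have h3 : Continuous (linFlux (Matrix.diagonal b)) :=
    (Matrix.toEuclideanLin (Matrix.diagonal b)).continuous_of_finiteDimensional
  exact h1.add (h3.measurable.comp h2)

/-- Starting the integral at `0` instead of `α` can only enlarge it, and frees the bound from the
entry time. -/
theorem enorm_sub_le_lintegral_residual {m : ℕ} {T : ℝ} {v : ℝ × ℝ → State m} {K : ℝ≥0}
    (hv : LipschitzOnWith K v (Icc 0 T ×ˢ Icc (0 : ℝ) 1)) (b : Fin m → ℝ) (i : Fin m) :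
    ∀ᵐ z : ℝ × ℝ, z ∈ cyl T → ∀ α ∈ Icc 0 z.1, z.2 - b i * (z.1 - α) ∈ Icc (0 : ℝ) 1 →
      ‖v z i - v (α, z.2 - b i * (z.1 - α)) i‖ₑ ≤
        ∫⁻ s in Ioc 0 z.1, ‖residual T b v (s, z.2 - b i * (z.1 - s)) i‖ₑ := by
  filter_upwards [enorm_sub_le_lintegral_characteristic hv (b i) i] with z hz hzc α hα hpos
  refine (hz hzc α hα hpos).trans (le_trans (le_of_eq ?_)
    (lintegral_mono_set (Ioc_subset_Ioc_left hα.1)))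
  refine setLIntegral_congr_fun measurableSet_Ioc fun s hs => ?_
  have hin : (s, z.2 - b i * (z.1 - s)) ∈ cyl T :=
    ⟨⟨hα.1.trans_lt hs.1, hs.2.trans_lt hzc.1.2⟩, characteristic_mem_Ioo hzc.2 hpos hs⟩
  simp only [residual, indicator_of_mem hin, PiLp.add_apply, linFlux_diagonal_apply]

/-- Duhamel bound for the components of the difference of the two solutions. -/
theorem enorm_sub_le_duhamel {m : ℕ} {T : ℝ} (hT : 0 < T) {b : Fin m → ℝ}
    {u v r : ℝ × ℝ → State m} {u₀ v₀ g W : ℝ → State m}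
    (hu₀ : MemLp u₀ ∞ (volume.restrict (Ioo (0 : ℝ) 1)))
    (hg : ∃ K : ℝ≥0, LipschitzOnWith K g (Icc 0 T))
    (hu : IsWeakSolution T (linFlux (Matrix.diagonal b)) u₀ u)
    (hub : AttainsIncoming T b g u) (hv : IsLipschitzSolution T b r v₀ g v)
    (hW : ∀ᵐ x, x ∈ Ioo (0 : ℝ) 1 → u₀ x - v₀ x = W x) (i : Fin m) :
    ∀ᵐ z : ℝ × ℝ, z ∈ cyl T → ‖u z i - v z i‖ₑ ≤
      ‖W (z.2 - b i * z.1) i‖ₑ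
        + ∫⁻ s in Ioc 0 z.1, ‖residual T b v (s, z.2 - b i * (z.1 - s)) i‖ₑ := by
  obtain ⟨K, hK⟩ := hv.lipschitz
  have hleft : ∀ᵐ z : ℝ × ℝ, 0 < b i → z ∈ cyl T → z.1 - z.2 / b i ∈ Ioo 0 T →
      u z i = g (z.1 - z.2 / b i) i := by
    by_cases hb : 0 < b i
    · filter_upwards [hub.ae_eq_left hu.memLp hg hb] with z hz _ using hz
    · exact ae_of_all _ fun z h => absurd h hb
  have hright : ∀ᵐ z : ℝ × ℝ, b i < 0 → z ∈ cyl T → z.1 - (z.2 - 1) / b i ∈ Ioo 0 T →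
      u z i = g (z.1 - (z.2 - 1) / b i) i := by
    by_cases hb : b i < 0
    · filter_upwards [hub.ae_eq_right hu.memLp hg hb] with z hz _ using hz
    · exact ae_of_all _ fun z h => absurd h hb
  -- Characteristics through the corners `(0,0)` and `(0,1)` form a null set; they are discarded so
  -- that the foot is negative, in `(0,1)`, or beyond `1`.
  have hcorner : ∀ a : ℝ, ∀ᵐ z : ℝ × ℝ, z.2 - b i * z.1 ≠ a := fun a =>
    (quasiMeasurePreserving_foot (b i)).ae (p := fun y => y ≠ a)
      (by simp [ae_iff])
  filter_upwards [hu.ae_eq_initial hT hu₀ i, hleft, hright, hcorner 0, hcorner 1,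
    (quasiMeasurePreserving_foot (b i)).ae hW, enorm_sub_le_lintegral_residual hK b i]
    with z h1 h2 h3 h4 h5 h6 h7 hz
  obtain ⟨⟨ht0, htT⟩, hx0, hx1⟩ := id hz
  rcases lt_or_gt_of_ne h4 with hneg | hpos
  -- The characteristic enters through `x = 0` at time `z.1 - z.2 / b i`, where both solutions equal
  -- `g`: no initial term is needed.
  · have hb : 0 < b i := by
      by_contra hb
      nlinarith [not_lt.1 hb]
    have hq : z.2 / b i < z.1 := by rw [div_lt_iff₀ hb]; linarith
    have hq0 : 0 < z.2 / b i := div_pos hx0 hb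
    have hα : z.1 - z.2 / b i ∈ Ioo 0 T := ⟨by linarith, by linarith⟩
    have hp : z.2 - b i * (z.1 - (z.1 - z.2 / b i)) = 0 := by field_simp; ring
    have h := h7 hz _ ⟨hα.1.le, by linarith⟩ (by rw [hp]; simp)
    rw [hp, hv.left i hb _ hα, ← h2 hb hz hα, enorm_sub_rev] at h
    exact h.trans le_add_self
  rcases lt_or_gt_of_ne h5 with hlt | hgt
  · have hin : z.2 - b i * z.1 ∈ Ioo (0 : ℝ) 1 := ⟨hpos, hlt⟩
    have h := h7 hz 0 ⟨le_rfl, ht0.le⟩ (by rw [sub_zero]; exact ⟨hpos.le, hlt.le⟩)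
    rw [sub_zero, hv.initial _ hin] at h
    rw [h1 hz hin, ← h6 hin]
    have e : u₀ (z.2 - b i * z.1) i - v z i =
        (u₀ (z.2 - b i * z.1) - v₀ (z.2 - b i * z.1)) i
          + (v₀ (z.2 - b i * z.1) i - v z i) := by
      simp
    rw [e]
    refine (enorm_add_le _ _).trans ?_
    gcongr
    rwa [enorm_sub_rev]
  · have hb : b i < 0 := by
      by_contra hb
      nlinarith [not_lt.1 hb]
    have hq : (z.2 - 1) / b i < z.1 := by rw [div_lt_iff_of_neg hb]; linarith
    have hq0 : 0 < (z.2 - 1) / b i := div_pos_of_neg_of_neg (by linarith) hb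
    have hα : z.1 - (z.2 - 1) / b i ∈ Ioo 0 T := ⟨by linarith, by linarith⟩
    have hp : z.2 - b i * (z.1 - (z.1 - (z.2 - 1) / b i)) = 1 := by
      have := hb.ne
      field_simp
      ring
    have h := h7 hz _ ⟨hα.1.le, by linarith⟩ (by rw [hp]; simp)
    rw [hp, hv.right i hb _ hα, ← h3 hb hz hα, enorm_sub_rev] at h
    exact h.trans le_add_self

/-! ### Passage to `L²` norms -/

/-- Minkowski's integral inequality in `L²`. -/
theorem lintegral_lintegral_sq_le {X S : Type*} [MeasurableSpace X] [MeasurableSpace S]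
    (μ : Measure X) (ν : Measure S) [SFinite μ] [SFinite ν] {F : X → S → ℝ≥0∞}
    (hF : Measurable (Function.uncurry F)) :
    (∫⁻ x, (∫⁻ s, F x s ∂ν) ^ (2 : ℝ) ∂μ) ^ (1 / 2 : ℝ)
      ≤ ∫⁻ s, (∫⁻ x, F x s ^ (2 : ℝ) ∂μ) ^ (1 / 2 : ℝ) ∂ν := by
  have hFs : ∀ s, Measurable fun x => F x s := fun s => hF.of_uncurry_right
  have hFx : ∀ x, Measurable fun s => F x s := fun x => hF.of_uncurry_left
  have hF' : Measurable (Function.uncurry fun s x => F x s) := hF.comp measurable_swap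
  set N : S → ℝ≥0∞ := fun s => (∫⁻ x, F x s ^ (2 : ℝ) ∂μ) ^ (1 / 2 : ℝ) with hN
  have hNm : Measurable N :=
    (Measurable.lintegral_prod_right' (f := fun p : S × X => F p.2 p.1 ^ (2 : ℝ))
      (hF'.pow_const _)).pow_const _
  -- The square is written as a double integral in `s` and `s'`, and Cauchy–Schwarz in `x` bounds
  -- each pairing by `N s * N s'`.
  have key : ∫⁻ x, (∫⁻ s, F x s ∂ν) ^ (2 : ℝ) ∂μ ≤ (∫⁻ s, N s ∂ν) ^ (2 : ℝ) := by
    calc ∫⁻ x, (∫⁻ s, F x s ∂ν) ^ (2 : ℝ) ∂μ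
        = ∫⁻ x, ∫⁻ s, F x s * ∫⁻ s', F x s' ∂ν ∂ν ∂μ := by
          refine lintegral_congr fun x => ?_
          rw [lintegral_mul_const _ (hFx x), ENNReal.rpow_two, sq]
      _ = ∫⁻ s, ∫⁻ x, F x s * ∫⁻ s', F x s' ∂ν ∂μ ∂ν := by
          refine lintegral_lintegral_swap (Measurable.aemeasurable ?_)
          have hI : Measurable fun x => ∫⁻ s', F x s' ∂ν := hF.lintegral_prod_right'
          exact hF.mul (hI.comp measurable_fst)
      _ = ∫⁻ s, ∫⁻ s', ∫⁻ x, F x s * F x s' ∂μ ∂ν ∂ν := by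
          refine lintegral_congr fun s => ?_
          rw [← lintegral_lintegral_swap]
          · refine lintegral_congr fun x => ?_
            rw [lintegral_const_mul _ (hFx x)]
          · refine Measurable.aemeasurable ?_
            exact ((hFs s).comp measurable_fst).mul hF
      _ ≤ ∫⁻ s, ∫⁻ s', N s * N s' ∂ν ∂ν := by
          refine lintegral_mono fun s => lintegral_mono fun s' => ?_
          exact ENNReal.lintegral_mul_le_Lp_mul_Lq μ Real.HolderConjugate.two_two
            (hFs s).aemeasurable (hFs s').aemeasurable
      _ = (∫⁻ s, N s ∂ν) ^ (2 : ℝ) := by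
          simp_rw [lintegral_const_mul _ hNm]
          rw [lintegral_mul_const _ hNm, ENNReal.rpow_two, sq]
  calc _ ≤ ((∫⁻ s, N s ∂ν) ^ (2 : ℝ)) ^ (1 / 2 : ℝ) := by gcongr
    _ = _ := by rw [← ENNReal.rpow_mul]; norm_num

lemma enorm_rpow_two_eq_sum {m : ℕ} (w : State m) :
    ‖w‖ₑ ^ (2 : ℝ) = ∑ i, ‖w i‖ₑ ^ (2 : ℝ) := by
  simp only [ENNReal.rpow_two, enorm_eq_nnnorm]
  norm_cast
  rw [EuclideanSpace.nnnorm_eq, NNReal.sq_sqrt]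

/-- Each component has its own shift, so the vector norm is read as a scalar `L²` norm on `Fin m ×
ℝ`. -/
lemma lintegral_count_prod {m : ℕ} {f : Fin m × ℝ → ℝ≥0∞} (hf : Measurable f) :
    ∫⁻ p, f p ∂(Measure.count.prod volume) = ∑ i, ∫⁻ x, f (i, x) := by
  rw [lintegral_prod _ hf.aemeasurable, lintegral_count, tsum_fintype]

/-- The `L²` norm is invariant under translating each component separately. -/
lemma lintegral_shifted_components {m : ℕ} {w : ℝ → State m} (hw : Measurable w)
    (d : Fin m → ℝ) :
    ∫⁻ p : Fin m × ℝ, ‖w (p.2 - d p.1) p.1‖ₑ ^ (2 : ℝ) ∂(Measure.count.prod volume)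
      = ∫⁻ x, ‖w x‖ₑ ^ (2 : ℝ) := by
  have hm : ∀ i, Measurable fun x => ‖w x i‖ₑ ^ (2 : ℝ) := fun i => by fun_prop
  rw [lintegral_count_prod]
  · simp only [enorm_rpow_two_eq_sum]
    rw [lintegral_finsetSum _ fun i _ => hm i]
    exact Finset.sum_congr rfl fun i _ =>
      lintegral_sub_right_eq_self (fun x => ‖w x i‖ₑ ^ (2 : ℝ)) (d i)
  · exact measurable_from_prod_countable_right fun i => (hm i).comp (by fun_prop)

lemma normL2_eq {m : ℕ} (w : ℝ → State m) :
    normL2 w = (∫⁻ x in Ioo (0 : ℝ) 1, ‖w x‖ₑ ^ (2 : ℝ)) ^ (1 / 2 : ℝ) := by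
  rw [normL2, eLpNorm_eq_lintegral_rpow_enorm_toReal (by simp) (by simp)]
  simp

/-- Extension by zero to the whole line makes translation invariance available. -/
lemma normL2_eq_of_extension {m : ℕ} {w W : ℝ → State m}
    (h : ∀ᵐ x, x ∈ Ioo (0 : ℝ) 1 → w x = W x) (h0 : ∀ x ∉ Ioo (0 : ℝ) 1, W x = 0) :
    normL2 w = (∫⁻ x, ‖W x‖ₑ ^ (2 : ℝ)) ^ (1 / 2 : ℝ) := by
  rw [normL2_eq, ← lintegral_indicator measurableSet_Ioo]
  congr 1
  refine lintegral_congr_ae ?_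
  filter_upwards [h] with x hx
  by_cases hxI : x ∈ Ioo (0 : ℝ) 1
  · rw [indicator_of_mem hxI, hx hxI]
  · rw [indicator_of_notMem hxI, h0 x hxI]
    simp

lemma normL1L2_eq_residual {m : ℕ} {T : ℝ} {b : Fin m → ℝ} {v r : ℝ × ℝ → State m}
    (h : ∀ᵐ z ∂(volume.restrict (cyl T)),
      dt v z + linFlux (Matrix.diagonal b) (dx v z) = r z) {t : ℝ} (ht : t ≤ T) :
    normL1L2 t r = ∫⁻ s in Ioc 0 t, (∫⁻ x, ‖residual T b v (s, x)‖ₑ ^ (2 : ℝ)) ^ (1 / 2 : ℝ) := by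
  rw [cyl, Measure.volume_eq_prod, ← Measure.prod_restrict] at h
  have h2 := Measure.ae_ae_of_ae_prod h
  rw [normL1L2, ← restrict_Ioo_eq_restrict_Ioc]
  refine lintegral_congr_ae ?_
  filter_upwards [ae_restrict_of_ae_restrict_of_subset (Ioo_subset_Ioo_right ht) h2,
    ae_restrict_mem measurableSet_Ioo] with s hs hsI
  refine normL2_eq_of_extension ?_ fun x hx => ?_
  · filter_upwards [(ae_restrict_iff' measurableSet_Ioo).1 hs] with x hx hxI
    have : (s, x) ∈ cyl T := ⟨⟨hsI.1, hsI.2.trans_le ht⟩, hxI⟩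
    rw [residual, indicator_of_mem this, hx hxI]
  · exact indicator_of_notMem (fun h => hx h.2) _

/-- `L²` stability estimate at almost every time. -/
theorem normL2_sub_le {m : ℕ} {T : ℝ} (hT : 0 < T) {b : Fin m → ℝ}
    {u v r : ℝ × ℝ → State m} {u₀ v₀ g : ℝ → State m}
    (hu₀ : MemLp u₀ ∞ (volume.restrict (Ioo (0 : ℝ) 1)))
    (hg : ∃ K : ℝ≥0, LipschitzOnWith K g (Icc 0 T))
    (hu : IsWeakSolution T (linFlux (Matrix.diagonal b)) u₀ u)
    (hub : AttainsIncoming T b g u) (hv : IsLipschitzSolution T b r v₀ g v) :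
    ∀ᵐ t ∂(volume.restrict (Ioo 0 T)),
      normL2 (fun x => u (t, x) - v (t, x))
        ≤ normL2 (fun x => u₀ x - v₀ x) + normL1L2 t r := by
  have hv₀ : AEStronglyMeasurable v₀ (volume.restrict (Ioo (0 : ℝ) 1)) := by
    obtain ⟨K, hK⟩ := hv.lipschitz
    have hc : ContinuousOn v₀ (Ioo (0 : ℝ) 1) := by
      have : ContinuousOn (fun x : ℝ => v (0, x)) (Ioo (0 : ℝ) 1) :=
        hK.continuousOn.comp (by fun_prop)
          fun x hx => ⟨⟨le_rfl, hT.le⟩, Ioo_subset_Icc_self hx⟩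
      exact this.congr fun x hx => (hv.initial x hx).symm
    exact hc.aestronglyMeasurable measurableSet_Ioo
  have hw₀ : AEMeasurable (fun x => u₀ x - v₀ x) (volume.restrict (Ioo (0 : ℝ) 1)) :=
    (hu₀.1.sub hv₀).aemeasurable
  -- A measurable representative is needed, since `W` is composed with shifts and used on the whole
  -- line.
  set W : ℝ → State m := (Ioo (0 : ℝ) 1).indicator (hw₀.mk _) with hWdef
  have hWm : Measurable W := hw₀.measurable_mk.indicator measurableSet_Ioo
  have hW : ∀ᵐ x, x ∈ Ioo (0 : ℝ) 1 → u₀ x - v₀ x = W x := by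
    filter_upwards [(ae_restrict_iff' measurableSet_Ioo).1 hw₀.ae_eq_mk] with x hx hxI
    rw [hWdef, indicator_of_mem hxI, hx hxI]
  have hRm := measurable_residual T b v
  set R := residual T b v with hR
  have hpt : ∀ᵐ t : ℝ, ∀ᵐ x : ℝ, ∀ i, (t, x) ∈ cyl T → ‖u (t, x) i - v (t, x) i‖ₑ ≤
      ‖W (x - b i * t) i‖ₑ + ∫⁻ s in Ioc 0 t, ‖R (s, x - b i * (t - s)) i‖ₑ :=
    Measure.ae_ae_of_ae_prod (ae_all_iff.2 fun i =>
      enorm_sub_le_duhamel hT hu₀ hg hu hub hv hW i)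
  rw [ae_restrict_iff' measurableSet_Ioo]
  filter_upwards [hpt] with t ht htI
  set P : Fin m × ℝ → ℝ≥0∞ := fun p => ‖W (p.2 - b p.1 * t) p.1‖ₑ with hP
  set F : Fin m × ℝ → ℝ → ℝ≥0∞ := fun p s => ‖R (s, p.2 - b p.1 * (t - s)) p.1‖ₑ with hF
  have hPm : Measurable P :=
    measurable_from_prod_countable_right fun i => by
      simp only [hP]
      exact Measurable.enorm (by fun_prop)
  have hFm : Measurable (Function.uncurry F) := by
    have h1 : Measurable fun q : Fin m × (ℝ × ℝ) =>
        ‖R (q.2.2, q.2.1 - b q.1 * (t - q.2.2)) q.1‖ₑ :=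
      measurable_from_prod_countable_right fun i => by
        simp only
        exact Measurable.enorm (by fun_prop)
    exact h1.comp (f := fun p : (Fin m × ℝ) × ℝ => (p.1.1, (p.1.2, p.2))) (by fun_prop)
  have hIm : Measurable fun p => ∫⁻ s in Ioc 0 t, F p s := hFm.lintegral_prod_right'
  have hsum : ∫⁻ x in Ioo (0 : ℝ) 1, ‖u (t, x) - v (t, x)‖ₑ ^ (2 : ℝ)
      ≤ ∫⁻ p, (P + fun p => ∫⁻ s in Ioc 0 t, F p s) p ^ (2 : ℝ)
        ∂(Measure.count.prod volume) := by
    have hPI : Measurable fun p => (P + fun p => ∫⁻ s in Ioc 0 t, F p s) p ^ (2 : ℝ) :=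
      (hPm.add hIm).pow_const _
    have hPi : ∀ i, Measurable fun x => (P + fun p => ∫⁻ s in Ioc 0 t, F p s) (i, x) ^ (2 : ℝ) :=
      fun i => hPI.comp measurable_prodMk_left
    rw [lintegral_count_prod hPI, ← lintegral_finsetSum _ fun i _ => hPi i]
    refine le_trans (lintegral_mono_ae ?_) (setLIntegral_le_lintegral (Ioo (0 : ℝ) 1) _)
    filter_upwards [ae_restrict_of_ae ht, ae_restrict_mem measurableSet_Ioo] with x hx hxI
    rw [enorm_rpow_two_eq_sum]
    refine Finset.sum_le_sum fun i _ => ?_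
    gcongr
    exact hx i ⟨htI, hxI⟩
  have hPn : (∫⁻ p, P p ^ (2 : ℝ) ∂(Measure.count.prod volume)) ^ (1 / 2 : ℝ)
      = normL2 (fun x => u₀ x - v₀ x) := by
    rw [normL2_eq_of_extension hW fun x hx => indicator_of_notMem hx _,
      ← lintegral_shifted_components hWm fun i => b i * t]
  have hFn : ∫⁻ s in Ioc 0 t,
        (∫⁻ p, F p s ^ (2 : ℝ) ∂(Measure.count.prod volume)) ^ (1 / 2 : ℝ)
      = normL1L2 t r := by
    rw [normL1L2_eq_residual hv.equation htI.2.le]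
    refine lintegral_congr fun s => ?_
    rw [← lintegral_shifted_components (w := fun x => residual T b v (s, x))
      (hRm.comp (by fun_prop)) fun i => b i * (t - s)]
  rw [normL2_eq, ← hPn, ← hFn]
  calc _ ≤ (∫⁻ p, (P + fun p => ∫⁻ s in Ioc 0 t, F p s) p ^ (2 : ℝ)
        ∂(Measure.count.prod volume)) ^ (1 / 2 : ℝ) := by gcongr
    _ ≤ _ := ENNReal.lintegral_Lp_add_le hPm.aemeasurable hIm.aemeasurable one_le_two
    _ ≤ _ := by
      gcongr
      exact lintegral_lintegral_sq_le _ _ hFm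

/-- This is `(a + c)² ≤ 2a² + 2c²`, with room to spare in `c`; if `a` or `c` is infinite, so is the
right-hand side. -/
lemma quarter_mul_sq_le {x a c : ℝ≥0∞} (h : x ≤ a + c) :
    1 / 4 * x ^ 2 ≤ 1 / 2 * a ^ 2 + c ^ 2 := by
  rcases eq_or_ne a ∞ with rfl | ha
  · simp [ENNReal.mul_top]
  rcases eq_or_ne c ∞ with rfl | hc
  · simp
  lift a to ℝ≥0 using ha
  lift c to ℝ≥0 using hc
  have hkey : (1 / 4 : ℝ≥0) * (a + c) ^ 2 ≤ 1 / 2 * a ^ 2 + c ^ 2 := by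
    rw [← NNReal.coe_le_coe]
    push_cast
    nlinarith [sq_nonneg ((a : ℝ) - c), sq_nonneg (c : ℝ)]
  calc 1 / 4 * x ^ 2 ≤ 1 / 4 * ((a : ℝ≥0∞) + c) ^ 2 := by gcongr
    _ = (((1 / 4 : ℝ≥0) * (a + c) ^ 2 : ℝ≥0) : ℝ≥0∞) := by
      push_cast
      simp
    _ ≤ ((1 / 2 * a ^ 2 + c ^ 2 : ℝ≥0) : ℝ≥0∞) := ENNReal.coe_le_coe.2 hkey
    _ = _ := by
      push_cast
      simp

end LinHyp

theorem mainTheorem6 (m : ℕ) (T : ℝ) (hT : 0 < T) (b : Fin m → ℝ)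
    (u : ℝ × ℝ → LinHyp.State m) (u₀ : ℝ → LinHyp.State m)
    (v : ℝ × ℝ → LinHyp.State m) (v₀ : ℝ → LinHyp.State m)
    (r : ℝ × ℝ → LinHyp.State m) (g : ℝ → LinHyp.State m)
    (hu₀ : MemLp u₀ ∞ (volume.restrict (Ioo (0 : ℝ) 1)))
    (hg : ∃ K : ℝ≥0, LipschitzOnWith K g (Icc 0 T))
    (hu : LinHyp.IsEntropySolution T (LinHyp.linFlux (Matrix.diagonal b))
      LinHyp.quadEntropy (LinHyp.quadEntropyFlux (Matrix.diagonal b)) u₀ u)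
    (hub : LinHyp.AttainsIncoming T b g u)
    (hv : LinHyp.IsLipschitzSolution T b r v₀ g v) :
    ∀ᵐ t ∂(volume.restrict (Ioo 0 T)),
      1 / 4 * LinHyp.normLinfL2 t (fun z => u z - v z) ^ 2
        ≤ 1 / 2 * LinHyp.normL2 (fun x => u₀ x - v₀ x) ^ 2
          + LinHyp.normL1L2 t r ^ 2 := by
  filter_upwards [ae_restrict_mem measurableSet_Ioo] with t ht
  refine LinHyp.quarter_mul_sq_le (essSup_le_of_ae_le _ ?_)
  filter_upwards [ae_restrict_of_ae_restrict_of_subset (Ioo_subset_Ioo_right ht.2.le)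
    (LinHyp.normL2_sub_le hT hu₀ hg hu.toIsWeakSolution hub hv),
    ae_restrict_mem measurableSet_Ioo] with s hs hsI
  refine hs.trans ?_
  gcongr
  -- The `L¹` norm of `r` increases with time, so its value at `t` serves for all `s < t`.
  exact lintegral_mono_set (Ioo_subset_Ioo_right hsI.2.le)
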